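/- Let $N,d\ge 1$ and $n,m\ge 0$ be integers, let $A\in\mathbb{R}^{n\times n}$, $B\in\mathbb{R}^{n\times m}$, $D\in\mathbb{R}^{n\times d}$, let $Q_0,\dots,Q_{N-1}\in\mathbb{R}^{n\times n}$ be symmetric positive semidefinite and $R_0,\dots,R_{N-1}\in\mathbb{R}^{m\times m}$ symmetric positive definite, let $\Sigma_w\in\mathbb{R}^{Nd\times Nd}$ be symmetric positive definite, and let $\varepsilon>0$. Put $\mathcal{Q}=\mathrm{blkdiag}(Q_0,\dots,Q_{N-1},0)$ and $\mathcal{R}=\mathrm{blkdiag}(R_0,\dots,R_{N-1})$. Let $\mathcal{B}\in\mathbb{R}^{(N+1)n\times Nm}$ and $\mathcal{D}\in\mathbb{R}^{(N+1)n\times Nd}$ be the block matrices whose blocks in block row $k\in\{0,\dots,N\}$ and block column $j\in\{0,\dots,N-1\}$ are $A^{k-1-j}B$ and $A^{k-1-j}D$, respectively, if $j<k$, and $0$ otherwise (so that $x=\mathcal{B}u+\mathcal{D}w$ stacks the solution of $x_{k+1}=Ax_k+Bu_k+Dw_k$, $x_0=0$). For $L\in\mathbb{R}^{Nm\times(N+1)n}$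 define $$\Xi(L)=\mathcal{D}^{\intercal}\big((I+\mathcal{B}L)^{\intercal}\mathcal{Q}(I+\mathcal{B}L)+L^{\intercal}\mathcal{R}L\big)\mathcal{D}.$$ Let $\mathbb{W}$ be the type-2 Wasserstein distance on $\mathbb{R}^{Nd}$ with respect to the Euclidean norm, and let $\mathbb{B}_\varepsilon$ be the set of all probability distributions $\mathbb{P}$ on $\mathbb{R}^{Nd}$ with finite second moment and $\mathbb{W}(\mathbb{P},\mathcal{N}(0,\Sigma_w))\le\varepsilon$. Then for every $L$ the maximum on the left below is attained and $$\max_{\mathbb{P}\in\mathbb{B}_\varepsilon}\mathbb{E}_{\mathbb{P}}\big[w^{\intercal}\Xi(L)w\big]=\inf_{\lambda\in\mathbb{R}:\ \lambda I\succ\Xi(L)}\ \lambda\Big(\varepsilon^2-\mathrm{tr}[\Sigma_w]+\lambda\,\mathrm{tr}\big[\Sigma_w(\lambda I-\Xi(L))^{-1}\big]\Big),$$ and the infimum on the right is attained (a minimum) whenever $\Xi(L)\neq0$. Moreover, the program on the right is convex: the set $\{(\lambda,L):\lambda I\succ\Xi(L)\}$ is convex, and the objective on the right is a jointly convex function of $(\lambda,L)$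 on it; in particular, for each fixed $L$ it is convex in $\lambda$. -/

import Mathlib

open MeasureTheory ProbabilityTheory
open scoped ENNReal Matrix

namespace DRSteering

noncomputable section

/-! ### The type-2 Wasserstein ambiguity set -/

/-- The set of couplings of `P` and `Q`: joint distributions with marginals `P` and `Q`. -/
def couplings {E : Type*} [MeasurableSpace E] (P Q : Measure E) : Set (Measure (E × E)) :=
  {π | π.map Prod.fst = P ∧ π.map Prod.snd = Q}

/-- The type-2 Wasserstein distance for the transportation cost `‖x - y‖`,
with values in `[0, ∞]`. -/
def wasserstein2 {E : Type*} [NormedAddCommGroup E] [MeasurableSpace E]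
    (P Q : Measure E) : ℝ≥0∞ :=
  (⨅ π ∈ couplings P Q, ∫⁻ z : E × E, ‖z.1 - z.2‖ₑ ^ 2 ∂π) ^ (1 / 2 : ℝ)

/-- The Wasserstein ambiguity set of radius `ε` around `P`: all probability distributions with
finite second moment whose type-2 Wasserstein distance to `P` is at most `ε`. -/
def wassersteinBall {E : Type*} [NormedAddCommGroup E] [MeasurableSpace E]
    (ε : ℝ) (P : Measure E) : Set (Measure E) :=
  {Q | IsProbabilityMeasure Q ∧ (∫⁻ x : E, ‖x‖ₑ ^ 2 ∂Q) < ∞ ∧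
    wasserstein2 Q P ≤ ENNReal.ofReal ε}

/-! ### The stacked linear system

Stacked vectors are indexed by (coordinate, time): the stacked state by `Fin n × Fin (N + 1)`, the
stacked input by `Fin m × Fin N`, the stacked noise by `Fin d × Fin N`. -/

/-- The strictly block lower-triangular matrix that maps a stacked input `(v₀, …, v_{N-1})` to the
stacked solution `(x₀, …, x_N)` of `x_{k+1} = A x_k + G v_k`, `x₀ = 0`: its block in block row `k`
and block column `j` is `A ^ (k - 1 - j) * G` if `j < k`, and `0` otherwise. -/
def stackedInput {n q : ℕ} (N : ℕ) (A : Matrix (Fin n) (Fin n) ℝ) (G : Matrix (Fin n) (Fin q) ℝ) :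
    Matrix (Fin n × Fin (N + 1)) (Fin q × Fin N) ℝ :=
  Matrix.of fun a b =>
    if (b.2 : ℕ) < (a.2 : ℕ) then (A ^ ((a.2 : ℕ) - 1 - (b.2 : ℕ)) * G) a.1 b.1 else 0

/-- The stacked state weight `blkdiag(Q₀, …, Q_{N-1}, 0)`. -/
def stackedStateWeight {n N : ℕ} (Q : Fin N → Matrix (Fin n) (Fin n) ℝ) :
    Matrix (Fin n × Fin (N + 1)) (Fin n × Fin (N + 1)) ℝ :=
  Matrix.blockDiagonal
    (Fin.snoc (α := fun _ => Matrix (Fin n) (Fin n) ℝ) Q 0)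

/-- The stacked input weight `blkdiag(R₀, …, R_{N-1})`. -/
def stackedInputWeight {m N : ℕ} (R : Fin N → Matrix (Fin m) (Fin m) ℝ) :
    Matrix (Fin m × Fin N) (Fin m × Fin N) ℝ :=
  Matrix.blockDiagonal R

/-- The matrix `Ξ(L) = 𝒟ᵀ ((I + ℬ L)ᵀ 𝒬 (I + ℬ L) + Lᵀ ℛ L) 𝒟` of the closed-loop quadratic cost
as a function of the stacked noise. -/
def Xi {n m d N : ℕ} (A : Matrix (Fin n) (Fin n) ℝ) (B : Matrix (Fin n) (Fin m) ℝ)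
    (D : Matrix (Fin n) (Fin d) ℝ) (Q : Fin N → Matrix (Fin n) (Fin n) ℝ)
    (R : Fin N → Matrix (Fin m) (Fin m) ℝ)
    (L : Matrix (Fin m × Fin N) (Fin n × Fin (N + 1)) ℝ) :
    Matrix (Fin d × Fin N) (Fin d × Fin N) ℝ :=
  (stackedInput N A D)ᵀ *
    ((1 + stackedInput N A B * L)ᵀ * stackedStateWeight Q * (1 + stackedInput N A B * L)
      + Lᵀ * stackedInputWeight R * L) * stackedInput N A D

/-! ### The two optimization problems -/

section
variable {ι : Type*} [Fintype ι] [DecidableEq ι]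

/-- The expectation `𝔼_P[wᵀ Ξ w]`. -/
def expectedQuadratic (Ξ : Matrix ι ι ℝ) (P : Measure (EuclideanSpace ℝ ι)) : ℝ :=
  ∫ w, w.ofLp ⬝ᵥ (Ξ *ᵥ w.ofLp) ∂P

/-- The feasible set `{lam : lam I ≻ Ξ}` of the program in `lam`. -/
def feasible (Ξ : Matrix ι ι ℝ) : Set ℝ :=
  {lam | (lam • (1 : Matrix ι ι ℝ) - Ξ).PosDef}

/-- The objective `lam (ε² - tr Σ + lam tr[Σ (lam I - Ξ)⁻¹])` of the program in `lam`. -/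
def objective (ε : ℝ) (S Ξ : Matrix ι ι ℝ) (lam : ℝ) : ℝ :=
  lam * (ε ^ 2 - S.trace + lam * (S * (lam • (1 : Matrix ι ι ℝ) - Ξ)⁻¹).trace)

end

end

end DRSteering

/-!
The proof rests on completing a square. Put `M = c I - Ξ`, which is positive definite for every
feasible multiplier `c`. For all points `x`, `y`,
`xᵀ Ξ x = c ‖x - y‖² + yᵀ (c² M⁻¹ - c I) y - (x - c M⁻¹ y)ᵀ M (x - c M⁻¹ y)`
(`quadratic_add_gap`). Dropping the last term and integrating against a nearly optimal coupling of
a distribution in the ball with the Gaussian gives weak duality, since the Gaussian second moments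
turn the right-hand side into the dual objective (`expectedQuadratic_le_objective`).

The last term vanishes along the linear map `T = c M⁻¹`. Hence, if `c` is such that the transport
cost `𝔼‖T y - y‖²` under the Gaussian equals `ε²`, then the image of the Gaussian under `T` lies in
the ball and its expected cost equals the dual objective at `c`, so both problems are solved.
Diagonalizing `Ξ` turns the equation for `c` into a scalar one, solvable by the intermediate value
theorem when `Ξ ≠ 0` because the covariance is positive definite (`exists_displacement`). For
`Ξ = 0` both values are `0`.

For joint convexity, the nonlinear part `c² tr(Σ M⁻¹)` of the objective is the maximum over
matrices `X` of `2 c tr(Σ X) - tr(Σ Xᵀ M X)`. Each of these functions is convex in `(c, L)`, because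
`Ξ` is convex in `L` in the Loewner order (`convexOn_objective`,
`posSemidef_Xi_convex_combination`).
-/

namespace DRSteering

/-! ### Positive semidefinite matrices -/

section Matrices

/-- Exact convexity defect of the matrix-valued quadratic map `G ↦ Gᵀ W G`; for positive
semidefinite `W` it shows that the map is convex in the Loewner order. -/
theorem quadratic_convex_combination {ι κ : Type*} [Fintype κ]
    {W : Matrix κ κ ℝ} {a b : ℝ} (hab : a + b = 1)
    (G H : Matrix κ ι ℝ) :
    a • (Gᵀ * W * G) + b • (Hᵀ * W * H) - (a • G + b • H)ᵀ * W * (a • G + b • H) =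
      (a * b) • ((G - H)ᵀ * W * (G - H)) := by
  obtain rfl : b = 1 - a := by linarith
  simp only [Matrix.transpose_add, Matrix.transpose_smul, Matrix.transpose_sub, Matrix.add_mul,
    Matrix.mul_add, Matrix.sub_mul, Matrix.mul_sub, Matrix.smul_mul, Matrix.mul_smul]
  module

theorem pos_of_mem_feasible {ι : Type*} [DecidableEq ι] [Nonempty ι] {X : Matrix ι ι ℝ}
    (hX : X.PosSemidef) {c : ℝ}
    (hc : c ∈ feasible X) : 0 < c := by
  have i : ι := Classical.arbitrary ι
  have h1 := Matrix.PosDef.diag_pos (show (c • (1 : Matrix ι ι ℝ) - X).PosDef from hc) (i := i)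
  have h2 := hX.diag_nonneg (i := i)
  simp at h1
  linarith

variable {ι κ : Type*} [Fintype ι] [Fintype κ]

theorem trace_mul_nonneg {S T : Matrix ι ι ℝ} (hS : S.PosSemidef) (hT : T.PosSemidef) :
    0 ≤ (S * T).trace := by
  classical
  open scoped MatrixOrder in
  obtain ⟨C, rfl⟩ := CStarAlgebra.nonneg_iff_eq_star_mul_self.mp hS.nonneg
  rw [Matrix.star_eq_conjTranspose, Matrix.mul_assoc, Matrix.trace_mul_comm]
  exact (hT.mul_mul_conjTranspose_same C).trace_nonneg

/-- Completing the square around the minimizer `M⁻¹ z` of `x ↦ x ⬝ᵥ M x - 2 (x ⬝ᵥ z)`. -/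
theorem dotProduct_sub_inv_mulVec [DecidableEq ι] {M : Matrix ι ι ℝ} (hM : M.PosDef) (x z : ι → ℝ) :
    (x - M⁻¹ *ᵥ z) ⬝ᵥ (M *ᵥ (x - M⁻¹ *ᵥ z)) =
      x ⬝ᵥ (M *ᵥ x) - 2 * (x ⬝ᵥ z) + z ⬝ᵥ (M⁻¹ *ᵥ z) := by
  have hu : IsUnit M.det := (Matrix.isUnit_iff_isUnit_det M).mp hM.isUnit
  have hz : M *ᵥ (M⁻¹ *ᵥ z) = z := by
    rw [Matrix.mulVec_mulVec, Matrix.mul_nonsing_inv _ hu, Matrix.one_mulVec]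
  have hs : (M⁻¹ *ᵥ z) ⬝ᵥ (M *ᵥ x) = x ⬝ᵥ z := by
    rw [Matrix.dotProduct_mulVec, ← Matrix.mulVec_transpose,
      show Mᵀ = M from hM.isHermitian, hz, dotProduct_comm]
  rw [Matrix.mulVec_sub, hz, sub_dotProduct, dotProduct_sub, dotProduct_sub, hs,
    dotProduct_comm (M⁻¹ *ᵥ z) z]
  ring

/-- The concave quadratic `X ↦ 2 c tr(S X) - tr(S Xᵀ M X)` is bounded above by `c² tr(S M⁻¹)`.
The bound is attained at `X = c M⁻¹` (`trace_quadratic_eq`), so `c² tr(S M⁻¹)` is a supremum of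
functions that are affine in `(c, M)`. -/
theorem trace_quadratic_le [DecidableEq ι] {S M : Matrix ι ι ℝ} (hS : S.PosSemidef) (hM : M.PosDef)
    (c : ℝ) (X : Matrix ι ι ℝ) :
    2 * c * (S * X).trace - (S * (Xᵀ * M * X)).trace ≤ c ^ 2 * (S * M⁻¹).trace := by
  have hu : IsUnit M.det := (Matrix.isUnit_iff_isUnit_det M).mp hM.isUnit
  have h := trace_mul_nonneg hS
    (hM.posSemidef.conjTranspose_mul_mul_same (X - c • M⁻¹))
  have hMt : M⁻¹ᵀ = M⁻¹ := hM.inv.isHermitian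
  have hSt : Sᵀ = S := hS.isHermitian
  have e : (X - c • M⁻¹)ᴴ * M * (X - c • M⁻¹) =
      Xᵀ * M * X - c • Xᵀ - c • X + c ^ 2 • M⁻¹ := by
    rw [Matrix.conjTranspose_eq_transpose_of_trivial, Matrix.transpose_sub,
      Matrix.transpose_smul, hMt]
    simp only [Matrix.sub_mul, Matrix.mul_sub, Matrix.smul_mul, Matrix.mul_smul,
      Matrix.nonsing_inv_mul _ hu, Matrix.one_mul, Matrix.mul_nonsing_inv_cancel_right _ _ hu]
    module
  have hX : (S * Xᵀ).trace = (S * X).trace := by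
    rw [← Matrix.trace_transpose, Matrix.transpose_mul, Matrix.transpose_transpose, hSt,
      Matrix.trace_mul_comm]
  rw [e] at h
  simp only [Matrix.mul_add, Matrix.mul_sub, Matrix.mul_smul, Matrix.trace_add, Matrix.trace_sub,
    Matrix.trace_smul, hX, smul_eq_mul] at h
  linarith

theorem trace_quadratic_eq [DecidableEq ι] {S M : Matrix ι ι ℝ} (hM : M.PosDef) (c : ℝ) :
    2 * c * (S * (c • M⁻¹)).trace - (S * ((c • M⁻¹)ᵀ * M * (c • M⁻¹))).trace =
      c ^ 2 * (S * M⁻¹).trace := by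
  have hu : IsUnit M.det := (Matrix.isUnit_iff_isUnit_det M).mp hM.isUnit
  have hMt : M⁻¹ᵀ = M⁻¹ := hM.inv.isHermitian
  simp only [Matrix.transpose_smul, hMt, Matrix.smul_mul, Matrix.mul_smul,
    Matrix.nonsing_inv_mul _ hu, Matrix.one_mul, Matrix.trace_smul, smul_eq_mul]
  ring

theorem posSemidef_blockDiagonal {o : Type*} [Fintype o] [DecidableEq o] {W : o → Matrix κ κ ℝ}
    (hW : ∀ k, (W k).PosSemidef) : (Matrix.blockDiagonal W).PosSemidef := by
  refine .of_dotProduct_mulVec_nonneg ?_ fun x => ?_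
  · rw [Matrix.IsHermitian, Matrix.blockDiagonal_conjTranspose]
    exact congrArg _ (funext fun k => (hW k).isHermitian)
  · have h : star x ⬝ᵥ (Matrix.blockDiagonal W *ᵥ x) =
        ∑ k, star (fun i => x (i, k)) ⬝ᵥ (W k *ᵥ fun i => x (i, k)) := by
      simp only [dotProduct, Matrix.mulVec, Matrix.blockDiagonal_apply, Fintype.sum_prod_type,
        ite_mul, zero_mul, Finset.sum_ite_eq, Finset.mem_univ, if_true]
      exact Finset.sum_comm
    rw [h]
    exact Finset.sum_nonneg fun k _ => (hW k).dotProduct_mulVec_nonneg _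

/-- The scalar equation that fixes the optimal multiplier: in an eigenbasis of `X` with eigenvalues
`e`, the transport cost of the optimal map is `∑ i, s i * (e i / (c - e i)) ^ 2`. It blows up as `c`
decreases to the largest eigenvalue and vanishes as `c → ∞`. -/
theorem exists_sum_sq_div_sub_eq {e s : ι → ℝ} (he : ∀ i, 0 ≤ e i) (he' : e ≠ 0)
    (hs : ∀ i, 0 < s i) {ε : ℝ} (hε : 0 < ε) :
    ∃ c, (∀ i, e i < c) ∧ ∑ i, s i * (e i / (c - e i)) ^ 2 = ε ^ 2 := by
  obtain ⟨i₁, hi₁⟩ : ∃ i, e i ≠ 0 := Function.ne_iff.mp he'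
  obtain ⟨i₀, -, hi₀⟩ := Finset.exists_max_image Finset.univ e ⟨i₁, Finset.mem_univ _⟩
  replace hi₀ : ∀ i, e i ≤ e i₀ := fun i => hi₀ i (Finset.mem_univ i)
  have hpos : 0 < e i₀ := ((he i₁).lt_of_ne hi₁.symm).trans_le (hi₀ i₁)
  set g : ℝ → ℝ := fun c => ∑ i, s i * (e i / (c - e i)) ^ 2 with hg
  have hcont : ContinuousOn g (Set.Ioi (e i₀)) := by
    refine continuousOn_finsetSum _ fun i _ =>
      continuousOn_const.mul ((continuousOn_const.div (by fun_prop) fun c hc => ?_).pow 2)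
    exact (sub_pos.2 ((hi₀ i).trans_lt hc)).ne'
  set σ := ∑ i, s i * e i ^ 2 with hσ
  have hsp : 0 < s i₀ * e i₀ ^ 2 := mul_pos (hs i₀) (pow_pos hpos 2)
  have hσ0 : 0 < σ := hsp.trans_le <|
    Finset.single_le_sum (f := fun i => s i * e i ^ 2)
      (fun i _ => mul_nonneg (hs i).le (sq_nonneg _)) (Finset.mem_univ i₀)
  -- At `e i₀ + δ₁` the top eigenvalue alone contributes `ε ^ 2`; at `e i₀ + δ₂` replacing every
  -- denominator by the smallest one, `δ₂`, gives `ε ^ 2`.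
  set δ₁ := Real.sqrt (s i₀ * e i₀ ^ 2) / ε with hδ₁
  set δ₂ := Real.sqrt σ / ε with hδ₂
  have hδ₁0 : 0 < δ₁ := div_pos (Real.sqrt_pos.2 hsp) hε
  have hδ₂0 : 0 < δ₂ := div_pos (Real.sqrt_pos.2 hσ0) hε
  have hg₁ : ε ^ 2 ≤ g (e i₀ + δ₁) := by
    refine le_trans (le_of_eq ?_) (Finset.single_le_sum
      (f := fun i => s i * (e i / (e i₀ + δ₁ - e i)) ^ 2)
      (fun i _ => mul_nonneg (hs i).le (sq_nonneg _)) (Finset.mem_univ i₀))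
    rw [add_sub_cancel_left, hδ₁, div_pow, div_pow, Real.sq_sqrt hsp.le]
    have := (hs i₀).ne'
    field_simp
  have hg₂ : g (e i₀ + δ₂) ≤ ε ^ 2 := by
    have h1 : g (e i₀ + δ₂) ≤ ∑ i, s i * e i ^ 2 * (ε ^ 2 / σ) := by
      refine Finset.sum_le_sum fun i _ => ?_
      rw [mul_assoc]
      refine mul_le_mul_of_nonneg_left ?_ (hs i).le
      have hd : δ₂ ≤ e i₀ + δ₂ - e i := by linarith [hi₀ i]
      calc (e i / (e i₀ + δ₂ - e i)) ^ 2 ≤ (e i / δ₂) ^ 2 :=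
            pow_le_pow_left₀ (div_nonneg (he i) (hδ₂0.le.trans hd))
              (div_le_div_of_nonneg_left (he i) hδ₂0 hd) 2
        _ = e i ^ 2 * (ε ^ 2 / σ) := by
            rw [hδ₂, div_pow, div_pow, Real.sq_sqrt hσ0.le]; field_simp
    rwa [← Finset.sum_mul, ← hσ, mul_div_cancel₀ _ hσ0.ne'] at h1
  have hsub : Set.uIcc (e i₀ + δ₂) (e i₀ + δ₁) ⊆ Set.Ioi (e i₀) := fun c hc =>
    (lt_min (lt_add_of_pos_right _ hδ₂0) (lt_add_of_pos_right _ hδ₁0)).trans_le hc.1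
  obtain ⟨c, hc, hgc⟩ := intermediate_value_uIcc (hcont.mono hsub) (Set.mem_uIcc_of_le hg₂ hg₁)
  exact ⟨c, fun i => (hi₀ i).trans_lt (hsub hc), hgc⟩

/-- The multiplier `c` and displacement `K` of the optimal transport map
`1 + K = c (c - X)⁻¹`, chosen such that moving a centred distribution with covariance `S` along this
map costs exactly `ε ^ 2`. -/
theorem exists_displacement [DecidableEq ι] {S X : Matrix ι ι ℝ} (hS : S.PosDef)
    (hX : X.PosSemidef) (hX0 : X ≠ 0) {ε : ℝ} (hε : 0 < ε) :
    ∃ c ∈ feasible X, ∃ K : Matrix ι ι ℝ,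
      c • (c • (1 : Matrix ι ι ℝ) - X)⁻¹ = 1 + K ∧ (S * (Kᵀ * K)).trace = ε ^ 2 := by
  obtain ⟨U, e, hUU, hUU', hspec, he0⟩ : ∃ (U : Matrix ι ι ℝ) (e : ι → ℝ), U * Uᵀ = 1 ∧
      Uᵀ * U = 1 ∧ X = U * Matrix.diagonal e * Uᵀ ∧ ∀ i, 0 ≤ e i := by
    refine ⟨hX.1.eigenvectorUnitary, hX.1.eigenvalues,
      Unitary.mul_star_self_of_mem hX.1.eigenvectorUnitary.2,
      Unitary.star_mul_self_of_mem hX.1.eigenvectorUnitary.2, ?_, hX.eigenvalues_nonneg⟩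
    have := hX.1.spectral_theorem
    rw [Unitary.conjStarAlgAut_apply] at this
    exact this
  have hs0 : ∀ i, 0 < (Uᵀ * S * U) i i := by
    intro i
    refine Matrix.PosDef.diag_pos (A := Uᴴ * S * U) (hS.conjTranspose_mul_mul_same ?_)
    intro x y hxy
    have := congrArg (fun v => Uᵀ *ᵥ v) hxy
    simpa [Matrix.mulVec_mulVec, hUU'] using this
  have he' : e ≠ 0 := by
    rintro rfl
    exact hX0 (by simp [hspec])
  obtain ⟨c, hce, hgc⟩ := exists_sum_sq_div_sub_eq he0 he' hs0 hε
  have hcs : c • (1 : Matrix ι ι ℝ) - X = U * Matrix.diagonal (fun i => c - e i) * Uᵀ := by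
    have : Matrix.diagonal (fun i => c - e i) = c • (1 : Matrix ι ι ℝ) - Matrix.diagonal e := by
      rw [← Matrix.diagonal_one, ← Matrix.diagonal_smul, Matrix.diagonal_sub]
      congr 1; ext i; simp
    rw [this, hspec]
    simp [Matrix.mul_sub, Matrix.sub_mul, hUU]
  have hinv : (c • (1 : Matrix ι ι ℝ) - X)⁻¹ = U * Matrix.diagonal (fun i => (c - e i)⁻¹) * Uᵀ := by
    refine Matrix.inv_eq_right_inv ?_
    rw [hcs]
    calc _ = U * (Matrix.diagonal (fun i => c - e i) * (Uᵀ * U) *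
          Matrix.diagonal (fun i => (c - e i)⁻¹)) * Uᵀ := by simp only [Matrix.mul_assoc]
      _ = 1 := by
        rw [hUU', Matrix.mul_one, Matrix.diagonal_mul_diagonal]
        have : (fun i => (c - e i) * (c - e i)⁻¹) = fun _ => 1 := by
          ext i; exact mul_inv_cancel₀ (sub_pos.2 (hce i)).ne'
        rw [this, Matrix.diagonal_one, Matrix.mul_one, hUU]
  refine ⟨c, ?_, U * Matrix.diagonal (fun i => e i / (c - e i)) * Uᵀ, ?_, ?_⟩
  · rw [feasible, Set.mem_ofPred_eq, hcs]
    refine (Matrix.PosDef.diagonal fun i => sub_pos.2 (hce i)).mul_mul_conjTranspose_same ?_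
    intro x y hxy
    have := congrArg (fun v => v ᵥ* Uᵀ) hxy
    simpa [Matrix.vecMul_vecMul, hUU] using this
  · have : Matrix.diagonal (fun i => e i / (c - e i)) =
        c • Matrix.diagonal (fun i => (c - e i)⁻¹) - (1 : Matrix ι ι ℝ) := by
      rw [← Matrix.diagonal_one, ← Matrix.diagonal_smul, Matrix.diagonal_sub]
      congr 1; ext i
      have := (sub_pos.2 (hce i)).ne'
      simp only [Pi.smul_apply, smul_eq_mul]
      field_simp
      ring
    rw [this, hinv]
    simp [Matrix.mul_sub, Matrix.sub_mul, hUU]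
  · rw [← hgc]
    simp only [Matrix.transpose_mul, Matrix.transpose_transpose, Matrix.diagonal_transpose]
    set Δ := Matrix.diagonal (fun i => e i / (c - e i)) with hΔ
    calc _ = (S * (U * (Δ * (Uᵀ * U) * Δ) * Uᵀ)).trace := by simp only [Matrix.mul_assoc]
      _ = ((Uᵀ * S * U) * Matrix.diagonal (fun i => (e i / (c - e i)) ^ 2)).trace := by
        rw [hUU', Matrix.mul_one, hΔ, Matrix.diagonal_mul_diagonal, ← Matrix.mul_assoc,
          Matrix.trace_mul_comm]
        simp only [Matrix.mul_assoc, sq]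
      _ = _ := by
        simp only [Matrix.trace, Matrix.diag_apply, Matrix.mul_diagonal]

end Matrices

/-! ### Second moments and the completed square -/

section Moments

variable {ι : Type*} [Fintype ι]

theorem integrable_quadratic {P : Measure (EuclideanSpace ℝ ι)}
    (hP : (∫⁻ x, ‖x‖ₑ ^ 2 ∂P) < ∞) (M : Matrix ι ι ℝ) :
    Integrable (fun w : EuclideanSpace ℝ ι => w.ofLp ⬝ᵥ (M *ᵥ w.ofLp)) P := by
  have hL : MemLp (id : EuclideanSpace ℝ ι → EuclideanSpace ℝ ι) 2 P := by
    refine ⟨aestronglyMeasurable_id, ?_⟩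
    rw [eLpNorm_lt_top_iff_lintegral_rpow_enorm_lt_top (by norm_num) (by norm_num)]
    simpa using hP
  have hc : ∀ i, MemLp (fun w : EuclideanSpace ℝ ι => w.ofLp i) 2 P := fun i =>
    hL.of_le (Measurable.aestronglyMeasurable (by fun_prop))
      (.of_forall fun w => PiLp.norm_apply_le w i)
  simp only [dotProduct, Matrix.mulVec, Finset.mul_sum]
  refine integrable_finsetSum _ fun i _ => integrable_finsetSum _ fun j _ => ?_
  have := ((hc i).integrable_mul (hc j)).const_mul (M i j)
  refine this.congr (.of_forall fun w => ?_)
  simp only [Pi.mul_apply]; ring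

variable [DecidableEq ι]

theorem lintegral_enorm_sq_multivariateGaussian_lt_top (S : Matrix ι ι ℝ) :
    (∫⁻ x, ‖x‖ₑ ^ 2 ∂multivariateGaussian 0 S) < ∞ := by
  have h : MemLp (id : EuclideanSpace ℝ ι → _) 2 (multivariateGaussian 0 S) :=
    IsGaussian.memLp_two_id
  have := (eLpNorm_lt_top_iff_lintegral_rpow_enorm_lt_top (by norm_num) (by norm_num)).1 h.2
  simpa using this

/-- The second moments of the centred Gaussian: `𝔼[wᵀ M w] = tr(S M)`. -/
theorem expectedQuadratic_multivariateGaussian {S : Matrix ι ι ℝ} (hS : S.PosSemidef)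
    (M : Matrix ι ι ℝ) :
    expectedQuadratic M (multivariateGaussian 0 S) = (S * M).trace := by
  have hL : MemLp (id : EuclideanSpace ℝ ι → _) 2 (multivariateGaussian 0 S) :=
    IsGaussian.memLp_two_id
  have hc : ∀ i, MemLp (fun w : EuclideanSpace ℝ ι => w.ofLp i) 2 (multivariateGaussian 0 S) :=
    fun i => hL.of_le (Measurable.aestronglyMeasurable (by fun_prop))
      (.of_forall fun w => PiLp.norm_apply_le w i)
  have hmean : ∀ i, ∫ w : EuclideanSpace ℝ ι, w.ofLp i ∂(multivariateGaussian 0 S) = 0 := by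
    intro i
    have := (EuclideanSpace.proj (𝕜 := ℝ) i).integral_comp_comm
      (IsGaussian.integrable_fun_id (μ := multivariateGaussian (0 : EuclideanSpace ℝ ι) S))
    simpa using this
  have hm : ∀ i j, ∫ w : EuclideanSpace ℝ ι, w.ofLp i * w.ofLp j ∂(multivariateGaussian 0 S)
      = S i j := by
    intro i j
    rw [← covariance_eval_multivariateGaussian (μ := 0) hS i j, covariance_eq_sub (hc i) (hc j),
      hmean]
    simp
  have hi : ∀ i j, Integrable (fun w : EuclideanSpace ℝ ι => w.ofLp i * w.ofLp j)
      (multivariateGaussian 0 S) := fun i j => (hc i).integrable_mul (hc j)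
  have e : (fun w : EuclideanSpace ℝ ι => w.ofLp ⬝ᵥ (M *ᵥ w.ofLp)) =
      fun w => ∑ i, ∑ j, M j i * (w.ofLp i * w.ofLp j) := by
    ext w
    simp only [dotProduct, Matrix.mulVec, Finset.mul_sum]
    rw [Finset.sum_comm]
    refine Finset.sum_congr rfl fun i _ => Finset.sum_congr rfl fun j _ => by ring
  rw [expectedQuadratic, e, integral_finsetSum]
  · simp only [Matrix.trace, Matrix.diag_apply, Matrix.mul_apply]
    refine Finset.sum_congr rfl fun i _ => ?_
    rw [integral_finsetSum _ fun j _ => (hi i j).const_mul _]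
    refine Finset.sum_congr rfl fun j _ => ?_
    rw [integral_const_mul, hm, mul_comm]
  · exact fun i _ => integrable_finsetSum _ fun j _ => (hi i j).const_mul _

/-- With `M = c - X`, the quadratic form of `X` at `x` falls short of
`c ‖x - y‖² + yᵀ (c² M⁻¹ - c) y` by the quadratic form of `M` at `x - c M⁻¹ y`. Positivity of that
gap is weak duality; its vanishing at `x = c M⁻¹ y` identifies the optimal transport map. -/
theorem quadratic_add_gap {X : Matrix ι ι ℝ} {c : ℝ} (hc : c ∈ feasible X)
    (x y : EuclideanSpace ℝ ι) :
    x.ofLp ⬝ᵥ (X *ᵥ x.ofLp) +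
      (x.ofLp - (c • (c • (1 : Matrix ι ι ℝ) - X)⁻¹) *ᵥ y.ofLp) ⬝ᵥ ((c • (1 : Matrix ι ι ℝ) - X) *ᵥ
        (x.ofLp - (c • (c • (1 : Matrix ι ι ℝ) - X)⁻¹) *ᵥ y.ofLp)) =
    c * ‖x - y‖ ^ 2 +
      y.ofLp ⬝ᵥ ((c ^ 2 • (c • (1 : Matrix ι ι ℝ) - X)⁻¹ - c • (1 : Matrix ι ι ℝ)) *ᵥ y.ofLp) := by
  have h := dotProduct_sub_inv_mulVec hc x.ofLp (c • y.ofLp)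
  rw [Matrix.smul_mulVec, ← Matrix.mulVec_smul, h]
  have hn : ‖x - y‖ ^ 2 = (x.ofLp - y.ofLp) ⬝ᵥ (x.ofLp - y.ofLp) := by
    rw [EuclideanSpace.real_norm_sq_eq]
    simp [dotProduct, sq]
  rw [hn]
  simp only [Matrix.sub_mulVec, Matrix.smul_mulVec, Matrix.one_mulVec, Matrix.mulVec_smul,
    dotProduct_sub, sub_dotProduct, dotProduct_smul, smul_dotProduct, smul_eq_mul]
  rw [dotProduct_comm y.ofLp x.ofLp]
  ring

theorem objective_eq (ε : ℝ) (S X : Matrix ι ι ℝ) (c : ℝ) :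
    objective ε S X c = c * ε ^ 2 +
      (S * (c ^ 2 • (c • (1 : Matrix ι ι ℝ) - X)⁻¹ - c • (1 : Matrix ι ι ℝ))).trace := by
  simp only [objective, Matrix.mul_sub, Matrix.mul_smul, Matrix.trace_sub, Matrix.trace_smul,
    smul_eq_mul, Matrix.mul_one]
  ring

end Moments

/-! ### Duality over the Wasserstein ball -/

section Duality

/-- The infimum in the Wasserstein distance need not be known to be attained: a coupling with cost
below any `r > ε²` suffices. -/
theorem exists_coupling_lt {E : Type*} [NormedAddCommGroup E] [MeasurableSpace E]
    {P Q : Measure E} {ε : ℝ} (hε : 0 ≤ ε) (h : wasserstein2 P Q ≤ ENNReal.ofReal ε) {r : ℝ}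
    (hr : ε ^ 2 < r) :
    ∃ π ∈ couplings P Q, ∫⁻ z : E × E, ‖z.1 - z.2‖ₑ ^ 2 ∂π < ENNReal.ofReal r := by
  have h1 : (⨅ π ∈ couplings P Q, ∫⁻ z : E × E, ‖z.1 - z.2‖ₑ ^ 2 ∂π) ≤
      ENNReal.ofReal (ε ^ 2) := by
    have := ENNReal.rpow_le_rpow h (z := 2) (by norm_num)
    rw [wasserstein2, ← ENNReal.rpow_mul] at this
    norm_num at this
    rwa [ENNReal.ofReal_pow hε]
  have h2 := h1.trans_lt ((ENNReal.ofReal_lt_ofReal_iff ((sq_nonneg ε).trans_lt hr)).2 hr)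
  simpa only [iInf_lt_iff, exists_prop] using h2

variable {ι : Type*} [Fintype ι] [DecidableEq ι]

/-- Weak duality. -/
theorem expectedQuadratic_le_objective {S X : Matrix ι ι ℝ} (hS : S.PosSemidef) {ε c : ℝ}
    (hε : 0 ≤ ε) (hc : c ∈ feasible X) (hc0 : 0 < c) {P : Measure (EuclideanSpace ℝ ι)}
    (hP : P ∈ wassersteinBall ε (multivariateGaussian 0 S)) :
    expectedQuadratic X P ≤ objective ε S X c := by
  obtain ⟨hprob, hP2, hW⟩ := hP
  rw [objective_eq]
  set Φ := c ^ 2 • (c • (1 : Matrix ι ι ℝ) - X)⁻¹ - c • (1 : Matrix ι ι ℝ) with hΦ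
  suffices h : ∀ r, ε ^ 2 < r → expectedQuadratic X P ≤ c * r + (S * Φ).trace by
    refine le_of_forall_pos_le_add fun δ hδ => ?_
    refine (h (ε ^ 2 + δ / c) (lt_add_of_pos_right _ (div_pos hδ hc0))).trans (le_of_eq ?_)
    field_simp
    ring
  intro r hr
  have hr0 : 0 < r := (sq_nonneg ε).trans_lt hr
  obtain ⟨π, ⟨hπ1, hπ2⟩, hπ⟩ := exists_coupling_lt hε hW hr
  have hm : Measurable fun z : EuclideanSpace ℝ ι × EuclideanSpace ℝ ι => ‖z.1 - z.2‖ ^ 2 := by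
    fun_prop
  have hen : ∀ z : EuclideanSpace ℝ ι × EuclideanSpace ℝ ι,
      ENNReal.ofReal (‖z.1 - z.2‖ ^ 2) = ‖z.1 - z.2‖ₑ ^ 2 := fun z => by
    rw [ENNReal.ofReal_pow (norm_nonneg _), ofReal_norm]
  have hcost : Integrable (fun z : EuclideanSpace ℝ ι × EuclideanSpace ℝ ι =>
      ‖z.1 - z.2‖ ^ 2) π := by
    refine ⟨hm.aestronglyMeasurable, ?_⟩
    rw [hasFiniteIntegral_iff_ofReal (.of_forall fun z => sq_nonneg _)]
    simp only [hen]
    exact hπ.trans ENNReal.ofReal_lt_top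
  have hcost_le : ∫ z, ‖z.1 - z.2‖ ^ 2 ∂π ≤ r := by
    rw [integral_eq_lintegral_of_nonneg_ae (.of_forall fun z => sq_nonneg _)
      hm.aestronglyMeasurable]
    simp only [hen]
    exact ENNReal.toReal_le_of_le_ofReal hr0.le hπ.le
  have hq : ∀ M : Matrix ι ι ℝ, Measurable fun w : EuclideanSpace ℝ ι =>
      w.ofLp ⬝ᵥ (M *ᵥ w.ofLp) := fun M => by
    simp only [dotProduct, Matrix.mulVec]; fun_prop
  have hi1 : Integrable (fun z : EuclideanSpace ℝ ι × EuclideanSpace ℝ ι =>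
      z.1.ofLp ⬝ᵥ (X *ᵥ z.1.ofLp)) π := by
    have := integrable_quadratic hP2 X
    rw [← hπ1] at this
    exact this.comp_measurable measurable_fst
  have hi2 : Integrable (fun z : EuclideanSpace ℝ ι × EuclideanSpace ℝ ι =>
      z.2.ofLp ⬝ᵥ (Φ *ᵥ z.2.ofLp)) π := by
    have := integrable_quadratic (lintegral_enorm_sq_multivariateGaussian_lt_top S) Φ
    rw [← hπ2] at this
    exact this.comp_measurable measurable_snd
  have e1 : expectedQuadratic X P = ∫ z, z.1.ofLp ⬝ᵥ (X *ᵥ z.1.ofLp) ∂π := by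
    rw [expectedQuadratic, ← hπ1, integral_map measurable_fst.aemeasurable
      (hq X).aestronglyMeasurable]
  have e2 : ∫ z, z.2.ofLp ⬝ᵥ (Φ *ᵥ z.2.ofLp) ∂π = (S * Φ).trace := by
    rw [← expectedQuadratic_multivariateGaussian hS, expectedQuadratic, ← hπ2,
      integral_map measurable_snd.aemeasurable (hq Φ).aestronglyMeasurable]
  calc expectedQuadratic X P
      ≤ ∫ z, (c * ‖z.1 - z.2‖ ^ 2 + z.2.ofLp ⬝ᵥ (Φ *ᵥ z.2.ofLp)) ∂π := by
        rw [e1]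
        refine integral_mono hi1 ((hcost.const_mul c).add hi2) fun z => ?_
        have h1 := quadratic_add_gap hc z.1 z.2
        have h2 := hc.posSemidef.dotProduct_mulVec_nonneg
          (z.1.ofLp - (c • (c • (1 : Matrix ι ι ℝ) - X)⁻¹) *ᵥ z.2.ofLp)
        rw [star_trivial] at h2
        simp only
        linarith
    _ = c * ∫ z, ‖z.1 - z.2‖ ^ 2 ∂π + (S * Φ).trace := by
        rw [integral_add (hcost.const_mul c) hi2, integral_const_mul, e2]
    _ ≤ c * r + (S * Φ).trace := by gcongr

/-- Moving each point `y` to `y + K y` transports the Gaussian to an element of the ball, by the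
coupling that this map induces. -/
theorem map_mem_wassersteinBall {S K : Matrix ι ι ℝ} (hS : S.PosSemidef) {ε : ℝ} (hε : 0 ≤ ε)
    (hK : (S * (Kᵀ * K)).trace ≤ ε ^ 2) :
    (multivariateGaussian 0 S).map (Matrix.toEuclideanCLM (𝕜 := ℝ) (1 + K)) ∈
      wassersteinBall ε (multivariateGaussian 0 S) := by
  set γ := multivariateGaussian (0 : EuclideanSpace ℝ ι) S with hγ
  set T := Matrix.toEuclideanCLM (𝕜 := ℝ) (1 + K) with hT
  have hTm : Measurable T := T.continuous.measurable
  refine ⟨Measure.isProbabilityMeasure_map hTm.aemeasurable, ?_, ?_⟩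
  · rw [lintegral_map (by fun_prop) hTm]
    calc ∫⁻ y, ‖T y‖ₑ ^ 2 ∂γ ≤ ∫⁻ y, ‖T‖ₑ ^ 2 * ‖y‖ₑ ^ 2 ∂γ := by
          refine lintegral_mono fun y => ?_
          rw [← mul_pow]
          gcongr
          exact T.le_opENorm y
      _ = ‖T‖ₑ ^ 2 * ∫⁻ y, ‖y‖ₑ ^ 2 ∂γ := lintegral_const_mul _ (by fun_prop)
      _ < ∞ := ENNReal.mul_lt_top (ENNReal.pow_lt_top enorm_lt_top)
          (lintegral_enorm_sq_multivariateGaussian_lt_top S)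
  · have hmp : Measurable fun y => (T y, y) := hTm.prodMk measurable_id
    have hcoup : γ.map (fun y => (T y, y)) ∈ couplings (γ.map T) γ := by
      refine ⟨?_, ?_⟩
      · rw [Measure.map_map measurable_fst hmp]; rfl
      · rw [Measure.map_map measurable_snd hmp]; exact Measure.map_id
    have hcost : ∫⁻ z, ‖z.1 - z.2‖ₑ ^ 2 ∂(γ.map fun y => (T y, y)) ≤ ENNReal.ofReal (ε ^ 2) := by
      rw [lintegral_map (by fun_prop) hmp]
      have e : ∀ y : EuclideanSpace ℝ ι, ‖T y - y‖ₑ ^ 2 =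
          ENNReal.ofReal (y.ofLp ⬝ᵥ ((Kᵀ * K) *ᵥ y.ofLp)) := by
        intro y
        have h1 : (T y - y).ofLp = K *ᵥ y.ofLp := by
          simp [hT, Matrix.ofLp_toEuclideanCLM]
        rw [← ofReal_norm, ← ENNReal.ofReal_pow (norm_nonneg _), EuclideanSpace.real_norm_sq_eq,
          h1, ← Matrix.mulVec_mulVec, Matrix.dotProduct_mulVec, Matrix.vecMul_transpose]
        simp [dotProduct, sq]
      simp only [e]
      rw [← ofReal_integral_eq_lintegral_ofReal
        (integrable_quadratic (lintegral_enorm_sq_multivariateGaussian_lt_top S) _)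
        (.of_forall fun y => ?_)]
      · refine ENNReal.ofReal_le_ofReal (le_trans (le_of_eq ?_) hK)
        exact expectedQuadratic_multivariateGaussian hS _
      · have := (Matrix.posSemidef_conjTranspose_mul_self K).dotProduct_mulVec_nonneg y.ofLp
        simpa using this
    calc wasserstein2 (γ.map T) γ ≤ ENNReal.ofReal (ε ^ 2) ^ (1 / 2 : ℝ) :=
          ENNReal.rpow_le_rpow ((iInf₂_le _ hcoup).trans hcost) (by norm_num)
      _ = ENNReal.ofReal ε := by
          rw [ENNReal.ofReal_rpow_of_nonneg (sq_nonneg _) (by norm_num), ← Real.sqrt_eq_rpow,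
            Real.sqrt_sq hε]

/-- The image of the Gaussian under the optimal map closes the duality gap: both the gap of
`quadratic_add_gap` and the slack in the transport budget vanish. -/
theorem expectedQuadratic_map {S X K : Matrix ι ι ℝ} (hS : S.PosSemidef) {ε c : ℝ}
    (hc : c ∈ feasible X) (hT : c • (c • (1 : Matrix ι ι ℝ) - X)⁻¹ = 1 + K)
    (hK : (S * (Kᵀ * K)).trace = ε ^ 2) :
    expectedQuadratic X
      ((multivariateGaussian 0 S).map (Matrix.toEuclideanCLM (𝕜 := ℝ) (1 + K))) =
      objective ε S X c := by
  rw [expectedQuadratic, integral_map (by fun_prop) (Measurable.aestronglyMeasurable (by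
    simp only [dotProduct, Matrix.mulVec]; fun_prop)), objective_eq]
  set Φ := c ^ 2 • (c • (1 : Matrix ι ι ℝ) - X)⁻¹ - c • (1 : Matrix ι ι ℝ) with hΦ
  have h : ∀ y : EuclideanSpace ℝ ι,
      (Matrix.toEuclideanCLM (𝕜 := ℝ) (1 + K) y).ofLp ⬝ᵥ
        (X *ᵥ (Matrix.toEuclideanCLM (𝕜 := ℝ) (1 + K) y).ofLp) =
      y.ofLp ⬝ᵥ ((c • (Kᵀ * K) + Φ) *ᵥ y.ofLp) := by
    intro y
    have h1 := quadratic_add_gap hc (Matrix.toEuclideanCLM (𝕜 := ℝ) (1 + K) y) y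
    have h2 : (Matrix.toEuclideanCLM (𝕜 := ℝ) (1 + K) y - y).ofLp = K *ᵥ y.ofLp := by
      simp [Matrix.ofLp_toEuclideanCLM]
    rw [hT, EuclideanSpace.real_norm_sq_eq, h2, Matrix.ofLp_toEuclideanCLM, sub_self,
      zero_dotProduct, add_zero] at h1
    rw [Matrix.ofLp_toEuclideanCLM, h1, Matrix.add_mulVec, dotProduct_add, Matrix.smul_mulVec,
      dotProduct_smul, ← Matrix.mulVec_mulVec, Matrix.dotProduct_mulVec _ Kᵀ,
      Matrix.vecMul_transpose, smul_eq_mul, hΦ]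
    simp only [dotProduct, sq]
  simp only [h]
  refine (expectedQuadratic_multivariateGaussian hS _).trans ?_
  rw [Matrix.mul_add, Matrix.trace_add, Matrix.mul_smul, Matrix.trace_smul, hK, smul_eq_mul]

/-- Strong duality. For `X = 0` the objective is `c ε²` on `c > 0`, whose infimum `0` is not
attained; otherwise the multiplier of the optimal transport map attains it. -/
theorem exists_isGreatest_isGLB [Nonempty ι] {S X : Matrix ι ι ℝ} (hS : S.PosDef)
    (hX : X.PosSemidef) {ε : ℝ} (hε : 0 < ε) :
    ∃ v : ℝ,
      IsGreatest (expectedQuadratic X '' wassersteinBall ε (multivariateGaussian 0 S)) v ∧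
      IsGLB (objective ε S X '' feasible X) v ∧
      (X ≠ 0 → IsLeast (objective ε S X '' feasible X) v) := by
  have hweak : ∀ P ∈ wassersteinBall ε (multivariateGaussian 0 S), ∀ c ∈ feasible X,
      expectedQuadratic X P ≤ objective ε S X c := fun P hP c hc =>
    expectedQuadratic_le_objective hS.posSemidef hε.le hc (pos_of_mem_feasible hX hc) hP
  by_cases hX0 : X = 0
  · subst hX0
    have hfeas : feasible (0 : Matrix ι ι ℝ) = Set.Ioi 0 := by
      ext c
      refine ⟨pos_of_mem_feasible hX, fun hc => ?_⟩
      rw [feasible, Set.mem_ofPred_eq, sub_zero]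
      exact Matrix.PosDef.one.smul hc
    have hobj : ∀ c ∈ Set.Ioi (0 : ℝ), objective ε S 0 c = c * ε ^ 2 := by
      intro c hc
      have hc' : c ≠ 0 := ne_of_gt hc
      have : (c • (1 : Matrix ι ι ℝ))⁻¹ = c⁻¹ • 1 :=
        Matrix.inv_eq_right_inv (by simp [hc'])
      rw [objective, sub_zero, this]
      simp only [Matrix.mul_smul, Matrix.mul_one, Matrix.trace_smul, smul_eq_mul]
      field_simp
      ring
    have hzero : ∀ P : Measure (EuclideanSpace ℝ ι),
        expectedQuadratic (0 : Matrix ι ι ℝ) P = 0 := by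
      intro P; simp [expectedQuadratic]
    have hmem := map_mem_wassersteinBall (K := 0) hS.posSemidef hε.le (by simp; positivity)
    refine ⟨0, ⟨⟨_, hmem, hzero _⟩, ?_⟩, ⟨?_, ?_⟩, fun h => (h rfl).elim⟩
    · rintro _ ⟨P, -, rfl⟩
      exact (hzero P).le
    · rintro _ ⟨c, hc, rfl⟩
      rw [hfeas] at hc
      rw [hobj c hc]
      exact mul_nonneg (le_of_lt hc) (sq_nonneg _)
    · intro b hb
      refine le_of_forall_pos_le_add fun δ hδ => ?_
      have hc : δ / ε ^ 2 ∈ Set.Ioi (0 : ℝ) := div_pos hδ (pow_pos hε 2)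
      have := hb ⟨δ / ε ^ 2, hfeas ▸ hc, hobj _ hc⟩
      rwa [div_mul_cancel₀ _ (pow_pos hε 2).ne', ← zero_add δ] at this
  · obtain ⟨c, hc, K, hT, hK⟩ := exists_displacement hS hX hX0 hε
    have hmem := map_mem_wassersteinBall hS.posSemidef hε.le hK.le
    have hval := expectedQuadratic_map hS.posSemidef hc hT hK
    have hleast : IsLeast (objective ε S X '' feasible X) (objective ε S X c) := by
      refine ⟨⟨c, hc, rfl⟩, ?_⟩
      rintro _ ⟨c', hc', rfl⟩
      rw [← hval]
      exact hweak _ hmem c' hc'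
    refine ⟨objective ε S X c, ⟨⟨_, hmem, hval⟩, ?_⟩, hleast.isGLB, fun _ => hleast⟩
    rintro _ ⟨P, hP, rfl⟩
    exact hweak P hP c hc

end Duality

/-! ### Joint convexity of the dual objective -/

section Convexity

/-- If `F` is convex in the Loewner order, then the dual objective is jointly convex in `(c, v)`:
up to a linear term it is a supremum over `X` of functions `2 c tr(S X) - tr(S Xᵀ (c - F v) X)`,
each of which is convex. -/
theorem convexOn_objective {V ι : Type*} [AddCommGroup V] [Module ℝ V] [Fintype ι] [DecidableEq ι]
    {F : V → Matrix ι ι ℝ} {S : Matrix ι ι ℝ} (hS : S.PosSemidef) (ε : ℝ)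
    (hF : ∀ u v : V, ∀ a b : ℝ, 0 ≤ a → 0 ≤ b → a + b = 1 →
      (a • F u + b • F v - F (a • u + b • v)).PosSemidef) :
    ConvexOn ℝ {p : ℝ × V | p.1 ∈ feasible (F p.2)} (fun p => objective ε S (F p.2) p.1) := by
  have hdecomp : ∀ p q : ℝ × V, ∀ a b : ℝ,
      (a • p + b • q).1 • (1 : Matrix ι ι ℝ) - F (a • p + b • q).2 =
        (a • (p.1 • (1 : Matrix ι ι ℝ) - F p.2) + b • (q.1 • (1 : Matrix ι ι ℝ) - F q.2)) +
          (a • F p.2 + b • F q.2 - F (a • p.2 + b • q.2)) := by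
    intro p q a b
    simp only [Prod.fst_add, Prod.snd_add, Prod.smul_fst, Prod.smul_snd, smul_eq_mul]
    module
  have hconv : Convex ℝ {p : ℝ × V | p.1 ∈ feasible (F p.2)} := by
    intro p hp q hq a b ha hb hab
    have hp' : (p.1 • (1 : Matrix ι ι ℝ) - F p.2).PosDef := hp
    have hq' : (q.1 • (1 : Matrix ι ι ℝ) - F q.2).PosDef := hq
    change Matrix.PosDef _
    rw [hdecomp]
    refine Matrix.PosDef.add_posSemidef ?_ (hF _ _ a b ha hb hab)
    rcases ha.eq_or_lt with rfl | ha
    · obtain rfl : b = 1 := by linarith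
      simpa using hq'
    · exact (hp'.smul ha).add_posSemidef (hq'.posSemidef.smul hb)
  refine ⟨hconv, fun p hp q hq a b ha hb hab => ?_⟩
  have hr := hconv hp hq ha hb hab
  set r := a • p + b • q with hrdef
  set Mp := p.1 • (1 : Matrix ι ι ℝ) - F p.2 with hMp
  set Mq := q.1 • (1 : Matrix ι ι ℝ) - F q.2 with hMq
  set Mr := r.1 • (1 : Matrix ι ι ℝ) - F r.2 with hMr
  set X := r.1 • Mr⁻¹ with hX
  -- `X` attains the supremum at the convex combination and is merely a competitor at the end points.
  have h0 := trace_quadratic_eq (S := S) (show Mr.PosDef from hr) r.1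
  rw [← hX] at h0
  have h1 := trace_quadratic_le hS (show Mp.PosDef from hp) p.1 X
  have h2 := trace_quadratic_le hS (show Mq.PosDef from hq) q.1 X
  have h3 : a * (S * (Xᵀ * Mp * X)).trace + b * (S * (Xᵀ * Mq * X)).trace ≤
      (S * (Xᵀ * Mr * X)).trace := by
    have h := trace_mul_nonneg hS
      ((hF p.2 q.2 a b ha hb hab).conjTranspose_mul_mul_same X)
    have e : Mr = a • Mp + b • Mq + (a • F p.2 + b • F q.2 - F (a • p.2 + b • q.2)) :=
      hdecomp p q a b
    rw [Matrix.conjTranspose_eq_transpose_of_trivial] at h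
    rw [e]
    simp only [Matrix.mul_add, Matrix.add_mul, Matrix.mul_smul, Matrix.smul_mul, Matrix.trace_add,
      Matrix.trace_smul, smul_eq_mul] at h ⊢
    linarith
  have hr1 : r.1 = a * p.1 + b * q.1 := by simp [hrdef]
  have h1' := mul_le_mul_of_nonneg_left h1 ha
  have h2' := mul_le_mul_of_nonneg_left h2 hb
  have key : r.1 ^ 2 * (S * Mr⁻¹).trace ≤
      a * (p.1 ^ 2 * (S * Mp⁻¹).trace) + b * (q.1 ^ 2 * (S * Mq⁻¹).trace) := by
    rw [← h0]
    have : 2 * r.1 * (S * X).trace =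
      a * (2 * p.1 * (S * X).trace) + b * (2 * q.1 * (S * X).trace) := by rw [hr1]; ring
    linarith
  simp only [objective, smul_eq_mul]
  rw [← hMp, ← hMq, ← hMr]
  have : r.1 * (ε ^ 2 - S.trace) = a * (p.1 * (ε ^ 2 - S.trace)) + b * (q.1 * (ε ^ 2 - S.trace)) := by
    rw [hr1]; ring
  linarith

end Convexity

/-! ### The closed-loop cost matrix -/

section System

variable {n m d N : ℕ}

theorem posSemidef_stackedStateWeight {Q : Fin N → Matrix (Fin n) (Fin n) ℝ}
    (hQ : ∀ k, (Q k).PosSemidef) : (stackedStateWeight Q).PosSemidef := by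
  refine posSemidef_blockDiagonal fun k => ?_
  induction k using Fin.lastCases with
  | last => simpa using Matrix.PosSemidef.zero
  | cast k => simpa using hQ k

theorem posSemidef_Xi (A : Matrix (Fin n) (Fin n) ℝ) (B : Matrix (Fin n) (Fin m) ℝ)
    (D : Matrix (Fin n) (Fin d) ℝ) {Q : Fin N → Matrix (Fin n) (Fin n) ℝ}
    (hQ : ∀ k, (Q k).PosSemidef) {R : Fin N → Matrix (Fin m) (Fin m) ℝ}
    (hR : ∀ k, (R k).PosSemidef) (L : Matrix (Fin m × Fin N) (Fin n × Fin (N + 1)) ℝ) :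
    (Xi A B D Q R L).PosSemidef :=
  ((posSemidef_stackedStateWeight hQ).conjTranspose_mul_mul_same _ |>.add
    ((posSemidef_blockDiagonal hR).conjTranspose_mul_mul_same L)).conjTranspose_mul_mul_same _

/-- `Ξ` is convex in the Loewner order, being a positive semidefinite quadratic function of `L`. -/
theorem posSemidef_Xi_convex_combination (A : Matrix (Fin n) (Fin n) ℝ)
    (B : Matrix (Fin n) (Fin m) ℝ)
    (D : Matrix (Fin n) (Fin d) ℝ) {Q : Fin N → Matrix (Fin n) (Fin n) ℝ}
    (hQ : ∀ k, (Q k).PosSemidef) {R : Fin N → Matrix (Fin m) (Fin m) ℝ}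
    (hR : ∀ k, (R k).PosSemidef) (L L' : Matrix (Fin m × Fin N) (Fin n × Fin (N + 1)) ℝ)
    {a b : ℝ} (ha : 0 ≤ a) (hb : 0 ≤ b) (hab : a + b = 1) :
    (a • Xi A B D Q R L + b • Xi A B D Q R L' - Xi A B D Q R (a • L + b • L')).PosSemidef := by
  have hG : 1 + stackedInput N A B * (a • L + b • L') =
      a • (1 + stackedInput N A B * L) + b • (1 + stackedInput N A B * L') := by
    obtain rfl : b = 1 - a := by linarith
    simp only [Matrix.mul_add, Matrix.mul_smul]
    module
  have h1 := quadratic_convex_combination (W := stackedStateWeight Q) hab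
    (1 + stackedInput N A B * L) (1 + stackedInput N A B * L')
  have h2 := quadratic_convex_combination (W := stackedInputWeight R) hab L L'
  have p1 := ((posSemidef_stackedStateWeight hQ).conjTranspose_mul_mul_same
    ((1 + stackedInput N A B * L) - (1 + stackedInput N A B * L'))).smul (mul_nonneg ha hb)
  have p2 := ((posSemidef_blockDiagonal hR).conjTranspose_mul_mul_same (L - L')).smul
    (mul_nonneg ha hb)
  simp only [Matrix.conjTranspose_eq_transpose_of_trivial] at p1 p2
  rw [← h1] at p1
  rw [← stackedInputWeight, ← h2] at p2
  have p := (p1.add p2).conjTranspose_mul_mul_same (stackedInput N A D)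
  rw [Matrix.conjTranspose_eq_transpose_of_trivial] at p
  convert p using 1
  rw [Xi, Xi, Xi, hG]
  simp only [Matrix.mul_add (stackedInput N A D)ᵀ, Matrix.add_mul _ _ (stackedInput N A D),
    Matrix.mul_sub (stackedInput N A D)ᵀ, Matrix.sub_mul _ _ (stackedInput N A D),
    Matrix.mul_smul (stackedInput N A D)ᵀ, Matrix.smul_mul _ _ (stackedInput N A D)]
  module

end System

end DRSteering

theorem theorem4 {n m d N : ℕ} (hd : 0 < d) (hN : 0 < N)
    (A : Matrix (Fin n) (Fin n) ℝ) (B : Matrix (Fin n) (Fin m) ℝ) (D : Matrix (Fin n) (Fin d) ℝ)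
    (Q : Fin N → Matrix (Fin n) (Fin n) ℝ) (hQ : ∀ k, (Q k).PosSemidef)
    (R : Fin N → Matrix (Fin m) (Fin m) ℝ) (hR : ∀ k, (R k).PosDef)
    (Sw : Matrix (Fin d × Fin N) (Fin d × Fin N) ℝ) (hSw : Sw.PosDef)
    (ε : ℝ) (hε : 0 < ε) :
    (∀ L : Matrix (Fin m × Fin N) (Fin n × Fin (N + 1)) ℝ, ∃ v : ℝ,
      IsGreatest (DRSteering.expectedQuadratic (DRSteering.Xi A B D Q R L) ''
        DRSteering.wassersteinBall ε (multivariateGaussian 0 Sw)) v ∧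
      IsGLB (DRSteering.objective ε Sw (DRSteering.Xi A B D Q R L) ''
        DRSteering.feasible (DRSteering.Xi A B D Q R L)) v ∧
      (DRSteering.Xi A B D Q R L ≠ 0 →
        IsLeast (DRSteering.objective ε Sw (DRSteering.Xi A B D Q R L) ''
          DRSteering.feasible (DRSteering.Xi A B D Q R L)) v)) ∧
    ConvexOn ℝ
      {p : ℝ × Matrix (Fin m × Fin N) (Fin n × Fin (N + 1)) ℝ |
        p.1 ∈ DRSteering.feasible (DRSteering.Xi A B D Q R p.2)}
      (fun p => DRSteering.objective ε Sw (DRSteering.Xi A B D Q R p.2) p.1) := by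
  have hR' : ∀ k, (R k).PosSemidef := fun k => (hR k).posSemidef
  have : Nonempty (Fin d × Fin N) := ⟨(⟨0, hd⟩, ⟨0, hN⟩)⟩
  exact ⟨fun L => DRSteering.exists_isGreatest_isGLB hSw
      (DRSteering.posSemidef_Xi A B D hQ hR' L) hε,
    DRSteering.convexOn_objective hSw.posSemidef ε fun L L' a b ha hb hab =>
      DRSteering.posSemidef_Xi_convex_combination A B D hQ hR' L L' ha hb hab⟩
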